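/- **Setting.** Let $m,t\ge 1$ and let $B\in\mathbb C^{n_1\times\cdots\times n_m}$ be a complex $m$-mode tensor. For $1\le\ell\le m$ let $k_{\ell 1},\dots,k_{\ell t}\ge 1$ be integers with $k_\ell:=\sum_{s=1}^t k_{\ell s}\le n_\ell$. Let $\mathrm{St}(k,n)=\{P\in\mathbb C^{n\times k}: P^{\mathrm H}P=I_k\}$. Matrices $P_\ell\in\mathbb C^{n_\ell\times k_\ell}$ are partitioned columnwise as $P_\ell=[P_{\ell 1},\dots,P_{\ell t}]$, $P_{\ell s}\in\mathbb C^{n_\ell\times k_{\ell s}}$. Let $$f(P_1,\dots,P_m)=\big\|\mathrm{BDiag}\big(B\times_1P_1^{\mathrm H}\times_2P_2^{\mathrm H}\cdots\times_mP_m^{\mathrm H}\big)\big\|_{\mathrm F}^2 ,$$ where $\times_\ell$ is the mode-$\ell$ product and $\mathrm{BDiag}(T)$ keeps the $t$ diagonal blocks, of sizes $k_{1s}\times\cdots\times k_{ms}$ $(1\le s\le t)$, of the $k_1\times\cdots\times k_m$ tensor $T$ and replaces all other entries by $0$. For $1\le \ell\le m$ and $1\le s\le t$ let $C_{\ell s}$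 be the mode-$\ell$ unfolding (a matrix with $n_\ell$ rows) of the product of $B$ with $P_{is}^{\mathrm H}$ along each mode $i\ne\ell$, let $H_{\ell s}=C_{\ell s}C_{\ell s}^{\mathrm H}$, and let $$\mathscr H_\ell(P_1,\dots,P_m)=[H_{\ell 1}P_{\ell 1},\dots,H_{\ell t}P_{\ell t}]\in\mathbb C^{n_\ell\times k_\ell},$$ which is, up to the constant factor $2$, the partial Euclidean gradient of $f$ with respect to $P_\ell$. An *orthonormal polar factor* of $X\in\mathbb C^{n\times k}$ is any $Q\in \mathrm{St}(k,n)$ such that $X=Q\Lambda$ for some Hermitian positive semidefinite $\Lambda$. **Iteration.** Start with $P_\ell^{(0)}\in\mathrm{St}(k_\ell,n_\ell)$ for all $\ell$. For $j=0,1,2,\dots$ and, in this order, $\ell=1,\dots,m$, let $P_\ell^{(j+1)}$ be an (arbitrary) orthonormal polar factor of $$\widehat{\mathscr H}_\ell^{(j)}=\mathscr H_\ell\big(P_1^{(j+1)},\dots,P_{\ell-1}^{(j+1)},P_\ell^{(j)},\dots,P_m^{(j)}\big).$$ **KKT condition.** $(P_1,\dots,P_m)$ satisfies the KKT condition if for all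 $\ell$: $P_\ell\in\mathrm{St}(k_\ell,n_\ell)$ and $\mathscr H_\ell(P_1,\dots,P_m)=P_\ell\Lambda_\ell$ with $\Lambda_\ell=\Lambda_\ell^{\mathrm H}$. It satisfies the polar form of the KKT condition if moreover $\Lambda_\ell=P_\ell^{\mathrm H}\mathscr H_\ell(P_1,\dots,P_m)\succeq0$ for all $\ell$. **Theorem.** Let $\{(P_1^{(j)},\dots,P_m^{(j)})\}_{j\ge0}$ be generated by this iteration. (a) The sequence $\{f(P_1^{(j)},\dots,P_m^{(j)})\}_j$ is monotonically increasing (i.e. nondecreasing) and convergent. For (b) and (c), let $(P_{*1},\dots,P_{*m})$ be an accumulation point of the sequence, let $\{(P_1^{(j)},\dots,P_m^{(j)})\}_{j\in\mathbb I}$ be a subsequence converging to it, let $(\widehat P_{*1},\dots,\widehat P_{*\,m-1})$ be an accumulation point of $\{(P_1^{(j+1)},\dots,P_{m-1}^{(j+1)})\}_{j\in\mathbb I}$, and let $\widehat{\mathscr H}_{*\ell}=\mathscr H_\ell(\widehat P_{*1},\dots,\widehat P_{*\,\ell-1},P_{*\ell},\dots,P_{*m})$. (b) For $1\le\ell\le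 m$, $$\widehat{\mathscr H}_{*\ell}=P_{*\ell}\Lambda_{*\ell},\qquad \Lambda_{*\ell}=P_{*\ell}^{\mathrm H}\,\widehat{\mathscr H}_{*\ell}\succeq0 .$$ As a result, if also $\widehat P_{*\ell}=P_{*\ell}$ for $1\le\ell\le m-1$, then $(P_{*1},\dots,P_{*m})$ satisfies the polar form of the KKT condition. (c) If $\operatorname{rank}\mathscr H_\ell(P_{*1},\dots,P_{*m})=k_\ell$ for $1\le\ell\le m-1$, then $\widehat P_{*\ell}=P_{*\ell}$ for $1\le\ell\le m-1$, and $(P_{*1},\dots,P_{*m})$ satisfies the KKT condition, in its polar form. (d) If $(P_{*1},\dots,P_{*m})$ is an isolated accumulation point of the sequence (some neighbourhood of it contains no other accumulation point of the sequence) and $\operatorname{rank}\mathscr H_\ell(P_{*1},\dots,P_{*m})=k_\ell$ for $1\le\ell\le m$, then the entire sequence converges to $(P_{*1},\dots,P_{*m})$. (e) For every $1\le\ell\le m$, $$\sum_{j=0}^\infty\sigma_{\min}(\widehat{\mathscr H}_\ell^{(j)})\,\big\|\sin\Theta\big(\mathcal R(P_\ell^{(j+1)}),\mathcal R(P_\ell^{(j)})\big)\big\|_{\mathrm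 F}^2<\infty,$$ $$\sum_{j=0}^\infty\sigma_{\min}(\widehat{\mathscr H}_\ell^{(j)})\,\frac{\big\|\widehat{\mathscr H}_\ell^{(j)}-P_\ell^{(j)}\big([P_\ell^{(j)}]^{\mathrm H}\widehat{\mathscr H}_\ell^{(j)}\big)\big\|_{\mathrm F}^2}{\big\|\widehat{\mathscr H}_\ell^{(j)}\big\|_{\mathrm F}^2}<\infty ,$$ where $\sigma_{\min}$ is the smallest of the $k_\ell$ singular values of an $n_\ell\times k_\ell$ matrix, $\mathcal R(\cdot)$ is the column space, and $\Theta(\cdot,\cdot)$ is the diagonal matrix of the canonical angles between two subspaces of equal dimension; a term of the second series with $\widehat{\mathscr H}_\ell^{(j)}=0$ is read as $0$. -/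

import Mathlib

open Filter Topology
open scoped Matrix ComplexOrder

noncomputable section

namespace PTBD

/-! ### Matrices -/

/-- The Frobenius norm of a complex matrix. -/
def frobNorm {ι κ : Type*} [Fintype ι] [Fintype κ] (X : Matrix ι κ ℂ) : ℝ :=
  √(∑ i, ∑ j, ‖X i j‖ ^ 2)

/-- The smallest of the `min (#rows) (#columns)` singular values of a matrix
(Mathlib lists the singular values in decreasing order, starting with index `0`). -/
def sigmaMin {ι κ : Type*} [Fintype ι] [Fintype κ] [DecidableEq κ] (X : Matrix ι κ ℂ) : ℝ :=
  (Matrix.toEuclideanLin X).singularValues (min (Fintype.card ι) (Fintype.card κ) - 1)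

/-- The complex Stiefel manifold: matrices with orthonormal columns. -/
def Stiefel (ι κ : Type*) [Fintype ι] [DecidableEq κ] : Set (Matrix ι κ ℂ) :=
  {P | Pᴴ * P = 1}

/-- `Q` is an orthonormal polar factor of `X`: it has orthonormal columns, and `X = Q * Λ` with
`Λ` Hermitian positive semidefinite. (`Q` is unique only if `X` has full column rank.) -/
def IsPolarFactor {ι κ : Type*} [Fintype ι] [Fintype κ] [DecidableEq κ]
    (X Q : Matrix ι κ ℂ) : Prop :=
  Q ∈ Stiefel ι κ ∧ ∃ Λ : Matrix κ κ ℂ, Λ.PosSemidef ∧ X = Q * Λ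

/-- The column space of a matrix. -/
def colSpace {ι κ : Type*} [Fintype κ] [DecidableEq κ] (X : Matrix ι κ ℂ) :
    Submodule ℂ (EuclideanSpace ℂ ι) :=
  LinearMap.range (Matrix.toEuclideanLin X)

/-! ### Canonical angles -/

/-- The `i`-th canonical angle between two subspaces of equal dimension `d` (for `i < d`): its
cosine is the `i`-th singular value of the orthogonal projection onto `U`, restricted to `V`. -/
def canonicalAngle {E : Type*} [NormedAddCommGroup E] [InnerProductSpace ℂ E]
    [FiniteDimensional ℂ E] (U V : Submodule ℂ E) (i : ℕ) : ℝ :=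
  Real.arccos
    (((U.orthogonalProjectionOnto : E →ₗ[ℂ] U) ∘ₗ V.subtype).singularValues i)

/-- `sin Θ(U, V)`: the diagonal matrix of the sines of the canonical angles between `U`, `V`. -/
def sinTheta {E : Type*} [NormedAddCommGroup E] [InnerProductSpace ℂ E]
    [FiniteDimensional ℂ E] (U V : Submodule ℂ E) :
    Matrix (Fin (Module.finrank ℂ V)) (Fin (Module.finrank ℂ V)) ℂ :=
  Matrix.diagonal fun i => ((Real.sin (canonicalAngle U V i) : ℝ) : ℂ)

/-! ### Tensors. A tensor is a function of its multi-index. -/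

/-- The Frobenius norm of a tensor. -/
def tensorFrobNorm {μ : Type*} [Fintype μ] [DecidableEq μ] {α : μ → Type*} [∀ i, Fintype (α i)]
    (T : (∀ i, α i) → ℂ) : ℝ :=
  √(∑ c, ‖T c‖ ^ 2)

/-- The multi-mode product `B ×₁ X₁ ×₂ X₂ ⋯`, with one matrix for each mode of the tensor `B`. -/
def modeProd {μ : Type*} [Fintype μ] [DecidableEq μ] {α β : μ → Type*} [∀ i, Fintype (β i)]
    (X : ∀ i, Matrix (α i) (β i) ℂ) (B : (∀ i, β i) → ℂ) : (∀ i, α i) → ℂ :=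
  fun c => ∑ x : ∀ i, β i, (∏ i, X i (c i) (x i)) * B x

/-- The unfolding of a tensor along mode `ℓ`: the row index is the `ℓ`-th index, the column index
is the multi-index of all the other modes. -/
def unfolding {μ : Type*} [DecidableEq μ] {β : μ → Type*} (ℓ : μ) (B : (∀ i, β i) → ℂ) :
    Matrix (β ℓ) (∀ i : {i // i ≠ ℓ}, β i) ℂ :=
  Matrix.of fun a x => B ((Equiv.piSplitAt ℓ β).symm (a, x))

/-! ### The optimization problem

There are `m` modes. Mode `ℓ` has size `n ℓ`, and `k_ℓ = ∑ s, κ ℓ s` is partitioned into `t` parts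
of sizes `κ ℓ 0, …, κ ℓ (t - 1)`. The `k_ℓ` columns are indexed by pairs `⟨s, b⟩`: the block `s`
and the position `b` inside that block. -/

/-- The `k_ℓ` column indices, partitioned into blocks. -/
abbrev Cols {m t : ℕ} (κ : Fin m → Fin t → ℕ) (ℓ : Fin m) : Type :=
  Σ s : Fin t, Fin (κ ℓ s)

/-- Tensors of size `n_1 × ⋯ × n_m`. -/
abbrev Tensor {m : ℕ} (n : Fin m → ℕ) : Type := (∀ ℓ, Fin (n ℓ)) → ℂ

/-- Tuples `(P_1, …, P_m)` with `P_ℓ` a complex `n_ℓ × k_ℓ` matrix. -/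
abbrev Tuple {m t : ℕ} (n : Fin m → ℕ) (κ : Fin m → Fin t → ℕ) : Type :=
  ∀ ℓ : Fin m, Matrix (Fin (n ℓ)) (Cols κ ℓ) ℂ

/-- Tuples `(P_1, …, P_{m-1})`: the last mode is left out. -/
abbrev HeadTuple {m t : ℕ} (n : Fin m → ℕ) (κ : Fin m → Fin t → ℕ) : Type :=
  ∀ ℓ : {ℓ : Fin m // (ℓ : ℕ) + 1 < m}, Matrix (Fin (n ℓ.1)) (Cols κ ℓ.1) ℂ

section

variable {m t : ℕ} {n : Fin m → ℕ} {κ : Fin m → Fin t → ℕ}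

/-- The block diagonal part of a tensor of size `k_1 × ⋯ × k_m`: the entries outside of the
diagonal blocks are replaced by zero. -/
def bdiag (T : (∀ ℓ, Cols κ ℓ) → ℂ) : (∀ ℓ, Cols κ ℓ) → ℂ :=
  open Classical in fun c => if ∃ s, ∀ ℓ, (c ℓ).1 = s then T c else 0

/-- The objective function
`f(P_1, …, P_m) = ‖BDiag(B ×₁ P_1ᴴ ×₂ P_2ᴴ ⋯ ×ₘ P_mᴴ)‖_F²`. -/
def objective (B : Tensor n) (P : Tuple n κ) : ℝ :=
  tensorFrobNorm (bdiag (modeProd (fun ℓ => (P ℓ)ᴴ) B)) ^ 2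

/-- The `s`-th column block `P_{ℓ s}` of `P_ℓ`. -/
def block {ℓ : Fin m} (X : Matrix (Fin (n ℓ)) (Cols κ ℓ) ℂ) (s : Fin t) :
    Matrix (Fin (n ℓ)) (Fin (κ ℓ s)) ℂ :=
  X.submatrix id fun b => ⟨s, b⟩

/-- `C_{ℓ s}`: the mode-`ℓ` unfolding of the product of `B` with `P_{i s}ᴴ` along each mode
`i ≠ ℓ`. (Row `a` is the product for the slice of `B` whose `ℓ`-th index is `a`.) -/
def matC (B : Tensor n) (P : Tuple n κ) (ℓ : Fin m) (s : Fin t) :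
    Matrix (Fin (n ℓ)) (∀ i : {i // i ≠ ℓ}, Fin (κ i s)) ℂ :=
  Matrix.of fun a =>
    modeProd (fun i : {i // i ≠ ℓ} => (block (P i) s)ᴴ) (unfolding ℓ B a)

/-- `H_{ℓ s} = C_{ℓ s} C_{ℓ s}ᴴ`. -/
def matH (B : Tensor n) (P : Tuple n κ) (ℓ : Fin m) (s : Fin t) :
    Matrix (Fin (n ℓ)) (Fin (n ℓ)) ℂ :=
  matC B P ℓ s * (matC B P ℓ s)ᴴ

/-- The partial gradient `ℋ_ℓ(P_1, …, P_m) = [H_{ℓ 1} P_{ℓ 1}, …, H_{ℓ t} P_{ℓ t}]`, without the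
constant factor `2` of the derivative of a quadratic form. -/
def partialGrad (B : Tensor n) (P : Tuple n κ) (ℓ : Fin m) :
    Matrix (Fin (n ℓ)) (Cols κ ℓ) ℂ :=
  Matrix.of fun a c => (matH B P ℓ c.1 * block (P ℓ) c.1) a c.2

/-- The KKT condition: `ℋ_ℓ(P) = P_ℓ Λ_ℓ` with `P_ℓ` having orthonormal columns and `Λ_ℓ`
Hermitian, for every `ℓ`. -/
def IsKKT (B : Tensor n) (P : Tuple n κ) : Prop :=
  ∀ ℓ, P ℓ ∈ Stiefel (Fin (n ℓ)) (Cols κ ℓ) ∧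
    ∃ Λ : Matrix (Cols κ ℓ) (Cols κ ℓ) ℂ, Λ.IsHermitian ∧ partialGrad B P ℓ = P ℓ * Λ

/-- The KKT condition in the form of `m` coupled polar decompositions:
`ℋ_ℓ(P) = P_ℓ Λ_ℓ` with `Λ_ℓ = P_ℓᴴ ℋ_ℓ(P) ⪰ 0`, for every `ℓ`. -/
def IsPolarKKT (B : Tensor n) (P : Tuple n κ) : Prop :=
  ∀ ℓ, P ℓ ∈ Stiefel (Fin (n ℓ)) (Cols κ ℓ) ∧
    partialGrad B P ℓ = P ℓ * ((P ℓ)ᴴ * partialGrad B P ℓ) ∧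
    ((P ℓ)ᴴ * partialGrad B P ℓ).PosSemidef

/-! ### The alternating iteration -/

/-- `(P'_1, …, P'_{ℓ-1}, P_ℓ, …, P_m)`. -/
def gsMix (P' P : Tuple n κ) (ℓ : Fin m) : Tuple n κ :=
  fun i => if i < ℓ then P' i else P i

/-- `(P'_1, …, P'_{ℓ-1}, P_ℓ, …, P_m)` for `P'` that is only given for the first `m - 1` modes. -/
def gsMixHead (P' : HeadTuple n κ) (P : Tuple n κ) (ℓ : Fin m) : Tuple n κ :=
  fun i => if h : i < ℓ then P' ⟨i, by omega⟩ else P i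

/-- `ℋ̂_ℓ^{(j)} = ℋ_ℓ(P_1^{(j+1)}, …, P_{ℓ-1}^{(j+1)}, P_ℓ^{(j)}, …, P_m^{(j)})`. -/
def hatGrad (B : Tensor n) (P : ℕ → Tuple n κ) (j : ℕ) (ℓ : Fin m) :
    Matrix (Fin (n ℓ)) (Cols κ ℓ) ℂ :=
  partialGrad B (gsMix (P (j + 1)) (P j) ℓ) ℓ

/-- The sequence is generated by the Gauss–Seidel-type alternating iteration: it starts with
matrices with orthonormal columns, and `P_ℓ^{(j+1)}` is an orthonormal polar factor
of `ℋ̂_ℓ^{(j)}`. -/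
def IsNPDoSequence (B : Tensor n) (P : ℕ → Tuple n κ) : Prop :=
  (∀ ℓ, P 0 ℓ ∈ Stiefel (Fin (n ℓ)) (Cols κ ℓ)) ∧
    ∀ j ℓ, IsPolarFactor (hatGrad B P j ℓ) (P (j + 1) ℓ)

end

/-! ### Accumulation points of sequences -/

/-- `y` is an accumulation point of the sequence `u` (every neighbourhood of `y` contains `u i`
for infinitely many indices `i`). -/
def IsAccumulationPoint {X : Type*} [TopologicalSpace X] (u : ℕ → X) (y : X) : Prop :=
  MapClusterPt y atTop u

/-- `y` is an isolated accumulation point of the sequence `u`: an accumulation point with a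
neighbourhood that contains no other accumulation point of `u`. -/
def IsIsolatedAccumulationPoint {X : Type*} [TopologicalSpace X] (u : ℕ → X) (y : X) : Prop :=
  IsAccumulationPoint u y ∧ ∃ U ∈ 𝓝 y, ∀ z ∈ U, IsAccumulationPoint u z → z = y

end PTBD

end

/-!
The iteration is a monotone ascent method. For fixed matrices in the other modes the objective is
the convex quadratic form `∑ₛ ‖P_{ℓs}ᴴ C_{ℓs}‖_F²` of `P_ℓ`, so it lies above its tangent at `P_ℓ`.
If `G = ℋ̂_ℓ` has the polar decomposition `G = Q Λ`, then the tangent takes at `Q` a value that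
exceeds the value at `P_ℓ` by `2 Re tr ((Q - P_ℓ)ᴴ G) = tr ((Q - P_ℓ) Λ (Q - P_ℓ)ᴴ) ≥ 0`
(`trace_gap`). This gap is a lower bound for the increase of the objective in the update
(`trace_le_objective_sub`), and since the objective is bounded on the compact product of the
Stiefel manifolds, the gaps are summable (`IsNPDoSequence.summable_stepGap`). All the claims come
from this.

* At a limit `(Q, P*)` of pairs of consecutive iterates the gaps vanish, so `(Q_ℓ - P*_ℓ) Λ = 0` and
  `Q_ℓ`, `P*_ℓ` are both polar factors of the same limit gradient, with the same Hermitian factor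
  (`IsNPDoSequence.exists_polar_of_tendsto`). If the gradients have full rank, then the Hermitian
  factors are invertible, and `Q_ℓ = P*_ℓ` mode by mode (`IsNPDoSequence.limits_eq_of_rank`).
* Full rank in all modes therefore makes consecutive iterates merge near `P*`; if `P*` is isolated,
  then the sequence cannot leave a small neighbourhood of `P*` any more
  (`IsIsolatedAccumulationPoint.tendsto`).
* As `Λ ≥ σ_min(G)`, the gap is at least `σ_min(G) ‖Q - P_ℓ‖_F²` (`sigmaMin_mul_frobNorm_sq_le`),
  and `‖Q - P_ℓ‖_F²` bounds both `‖sin Θ‖_F²` (`frobNorm_sinTheta_colSpace_le`) and the normalized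
  residual (`IsPolarFactor.residual_le`).
-/

namespace PTBD

/-! ### The Frobenius norm and polar factors -/

section Frobenius

variable {ι κ μ : Type*} [Fintype ι] [Fintype κ] [Fintype μ]

theorem frobNorm_nonneg (X : Matrix ι κ ℂ) : 0 ≤ frobNorm X := Real.sqrt_nonneg _

theorem frobNorm_sq (X : Matrix ι κ ℂ) : frobNorm X ^ 2 = ∑ i, ∑ j, ‖X i j‖ ^ 2 :=
  Real.sq_sqrt (by positivity)

theorem frobNorm_sq_eq_trace (X : Matrix ι κ ℂ) : frobNorm X ^ 2 = (Xᴴ * X).trace.re := by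
  rw [frobNorm_sq, Finset.sum_comm]
  simp only [Matrix.trace, Matrix.diag, Matrix.mul_apply, Matrix.conjTranspose_apply,
    Complex.re_sum]
  refine Finset.sum_congr rfl fun j _ => Finset.sum_congr rfl fun i _ => ?_
  rw [← Complex.normSq_eq_norm_sq, Complex.star_def, Complex.normSq_apply]
  simp

theorem frobNorm_conjTranspose (X : Matrix ι κ ℂ) : frobNorm Xᴴ = frobNorm X := by
  unfold frobNorm
  rw [Finset.sum_comm]
  simp

theorem frobNorm_mul_le (X : Matrix ι κ ℂ) (Y : Matrix κ μ ℂ) :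
    frobNorm (X * Y) ≤ frobNorm X * frobNorm Y := by
  have := Matrix.frobenius_norm_mul X Y
  rw [Matrix.frobenius_norm_def, Matrix.frobenius_norm_def, Matrix.frobenius_norm_def] at this
  simpa [frobNorm, Real.sqrt_eq_rpow] using this

theorem trace_mul_posSemidef_mul_nonneg {Λ : Matrix κ κ ℂ} (hΛ : Λ.PosSemidef)
    (X : Matrix ι κ ℂ) : 0 ≤ (X * Λ * Xᴴ).trace.re :=
  (Complex.nonneg_iff.1 (hΛ.mul_mul_conjTranspose_same X).trace_nonneg).1

theorem mul_eq_zero_of_trace_eq_zero {Λ : Matrix κ κ ℂ} (hΛ : Λ.PosSemidef)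
    {X : Matrix ι κ ℂ} (h : (X * Λ * Xᴴ).trace.re = 0) : X * Λ = 0 := by
  classical
  obtain ⟨S, rfl⟩ : ∃ S : Matrix κ κ ℂ, Λ = Sᴴ * S := by
    open scoped MatrixOrder in
    exact CStarAlgebra.nonneg_iff_eq_star_mul_self.mp hΛ.nonneg
  have h2 : frobNorm (S * Xᴴ) ^ 2 = 0 := by
    rw [frobNorm_sq_eq_trace, ← h]
    simp [Matrix.conjTranspose_mul, Matrix.mul_assoc]
  have h3 : S * Xᴴ = 0 := by
    rw [frobNorm_sq] at h2
    ext i j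
    have := (Finset.sum_eq_zero_iff_of_nonneg (fun _ _ => by positivity)).1 h2 i (Finset.mem_univ _)
    have := (Finset.sum_eq_zero_iff_of_nonneg (fun _ _ => by positivity)).1 this j
      (Finset.mem_univ _)
    simpa using this
  have h4 : X * Sᴴ = 0 := by simpa using congrArg Matrix.conjTranspose h3
  rw [← Matrix.mul_assoc, h4, Matrix.zero_mul]

variable [DecidableEq κ]

theorem frobNorm_mul_of_mem_stiefel {Q : Matrix ι κ ℂ} (hQ : Q ∈ Stiefel ι κ)
    (X : Matrix κ μ ℂ) : frobNorm (Q * X) = frobNorm X := by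
  have hQ' : Qᴴ * Q = 1 := hQ
  have : frobNorm (Q * X) ^ 2 = frobNorm X ^ 2 := by
    rw [frobNorm_sq_eq_trace, frobNorm_sq_eq_trace, Matrix.conjTranspose_mul, Matrix.mul_assoc,
      ← Matrix.mul_assoc Qᴴ, hQ', Matrix.one_mul]
  exact (sq_eq_sq₀ (frobNorm_nonneg _) (frobNorm_nonneg _)).1 this

/-- Removing from the columns of `Y` their components in the column space of `P` does not
increase the Frobenius norm. -/
theorem frobNorm_sub_proj_le {P : Matrix ι κ ℂ} (hP : P ∈ Stiefel ι κ) (Y : Matrix ι μ ℂ) :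
    frobNorm (Y - P * (Pᴴ * Y)) ≤ frobNorm Y := by
  have hP' : Pᴴ * P = 1 := hP
  have h : (Y - P * (Pᴴ * Y))ᴴ * (Y - P * (Pᴴ * Y)) = Yᴴ * Y - (Pᴴ * Y)ᴴ * (Pᴴ * Y) := by
    have h1 : (P * (Pᴴ * Y))ᴴ * (P * (Pᴴ * Y)) = (Pᴴ * Y)ᴴ * (Pᴴ * Y) := by
      rw [Matrix.conjTranspose_mul P, Matrix.mul_assoc, ← Matrix.mul_assoc Pᴴ, hP',
        Matrix.one_mul]
    rw [Matrix.conjTranspose_sub, Matrix.sub_mul, Matrix.mul_sub, Matrix.mul_sub, h1]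
    simp [Matrix.conjTranspose_mul, Matrix.mul_assoc]
  have h2 : frobNorm (Y - P * (Pᴴ * Y)) ^ 2 = frobNorm Y ^ 2 - frobNorm (Pᴴ * Y) ^ 2 := by
    simp only [frobNorm_sq_eq_trace]
    rw [h, Matrix.trace_sub, Complex.sub_re]
  exact (sq_le_sq₀ (frobNorm_nonneg _) (frobNorm_nonneg _)).1
    (by rw [h2]; linarith [sq_nonneg (frobNorm (Pᴴ * Y))])

/-- If `Λ ⪰ 0`, this says that among the matrices `P` with orthonormal columns the polar factor `Q`
of `Q * Λ` maximizes `Re tr (Pᴴ * (Q * Λ))`, and it quantifies by how much `P` falls short. -/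
theorem trace_gap {P Q : Matrix ι κ ℂ} (hP : P ∈ Stiefel ι κ) (hQ : Q ∈ Stiefel ι κ)
    {Λ : Matrix κ κ ℂ} (hΛ : Λ.IsHermitian) :
    ((Q - P) * Λ * (Q - P)ᴴ).trace.re = 2 * ((Q - P)ᴴ * (Q * Λ)).trace.re := by
  have hP' : Pᴴ * P = 1 := hP
  have hQ' : Qᴴ * Q = 1 := hQ
  have h1 : (Qᴴ * Q * Λ).trace = Λ.trace := by rw [hQ', Matrix.one_mul]
  have h2 : (Pᴴ * P * Λ).trace = Λ.trace := by rw [hP', Matrix.one_mul]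
  have h3 : (Qᴴ * P * Λ).trace.re = (Pᴴ * Q * Λ).trace.re := by
    have : (Qᴴ * P * Λ)ᴴ.trace = (Pᴴ * Q * Λ).trace := by
      rw [Matrix.conjTranspose_mul, Matrix.conjTranspose_mul, Matrix.conjTranspose_conjTranspose,
        hΛ.eq, Matrix.trace_mul_comm]
    rw [← this, Matrix.trace_conjTranspose, Complex.star_def, Complex.conj_re]
  have hl : ((Q - P) * Λ * (Q - P)ᴴ).trace =
      (Qᴴ * Q * Λ).trace - (Pᴴ * Q * Λ).trace - (Qᴴ * P * Λ).trace + (Pᴴ * P * Λ).trace := by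
    rw [Matrix.trace_mul_comm, ← Matrix.mul_assoc, Matrix.conjTranspose_sub, Matrix.sub_mul,
      Matrix.mul_sub, Matrix.mul_sub, Matrix.sub_mul, Matrix.sub_mul, Matrix.sub_mul]
    simp only [Matrix.trace_sub]
    ring
  have hr : ((Q - P)ᴴ * (Q * Λ)).trace = (Qᴴ * Q * Λ).trace - (Pᴴ * Q * Λ).trace := by
    rw [← Matrix.mul_assoc, Matrix.conjTranspose_sub, Matrix.sub_mul, Matrix.sub_mul,
      Matrix.trace_sub]
  rw [hl, hr, h1, h2]
  simp only [Complex.sub_re, Complex.add_re, h3]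
  ring

end Frobenius

/-! ### Singular values and canonical angles -/

section SingularValues

variable {E F : Type*} [NormedAddCommGroup E] [InnerProductSpace ℂ E] [FiniteDimensional ℂ E]
  [NormedAddCommGroup F] [InnerProductSpace ℂ F] [FiniteDimensional ℂ F]

theorem sum_sq_singularValues {ι : Type*} [Fintype ι] (T : E →ₗ[ℂ] F)
    (b : OrthonormalBasis ι ℂ E) :
    ∑ i : Fin (Module.finrank ℂ E), T.singularValues i ^ 2 = ∑ i, ‖T (b i)‖ ^ 2 := by
  have hs := T.isSymmetric_adjoint_comp_self
  have h1 := LinearMap.trace_eq_sum_inner (LinearMap.adjoint T ∘ₗ T) b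
  have h2 := LinearMap.trace_eq_sum_inner (LinearMap.adjoint T ∘ₗ T) (hs.eigenvectorBasis rfl)
  rw [h1] at h2
  have h3 := congrArg Complex.re h2
  simp only [hs.apply_eigenvectorBasis, Complex.re_sum] at h3
  simp only [LinearMap.comp_apply, LinearMap.adjoint_inner_right, inner_self_eq_norm_sq_to_K,
    inner_smul_right] at h3
  simp only [OrthonormalBasis.norm_eq_one] at h3
  simp only [T.sq_singularValues_fin rfl]
  rw [← Finset.sum_congr rfl fun i _ => ?_, ← h3]
  · refine Finset.sum_congr rfl fun i _ => ?_
    norm_cast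
  · norm_num

theorem singularValues_last_mul_norm_le (T : E →ₗ[ℂ] F) (x : E) :
    T.singularValues (Module.finrank ℂ E - 1) * ‖x‖ ≤ ‖T x‖ := by
  have hs := T.isSymmetric_adjoint_comp_self
  let b := hs.eigenvectorBasis rfl
  have h1 : ‖T x‖ ^ 2 = ∑ i : Fin (Module.finrank ℂ E), T.singularValues i ^ 2 * ‖inner ℂ (b i) x‖ ^ 2 := by
    have := b.sum_inner_mul_inner x ((LinearMap.adjoint T ∘ₗ T) x)
    rw [LinearMap.comp_apply, LinearMap.adjoint_inner_right, inner_self_eq_norm_sq_to_K] at this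
    have h := congrArg Complex.re this
    rw [Complex.re_sum] at h
    rw [show ‖T x‖ ^ 2 = ((‖T x‖ : ℂ) ^ 2).re by norm_cast]
    refine h.symm.trans (Finset.sum_congr rfl fun i _ => ?_)
    rw [← LinearMap.comp_apply, ← hs (b i) x, hs.apply_eigenvectorBasis, inner_smul_left,
      T.sq_singularValues_fin rfl, ← inner_conj_symm x (b i)]
    rw [mul_left_comm, Complex.conj_mul']
    rw [RCLike.conj_ofReal, RCLike.ofReal_eq_complex_ofReal, ← Complex.ofReal_pow, Complex.re_ofReal_mul,
      Complex.ofReal_re]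
  have h2 : ‖x‖ ^ 2 = ∑ i, ‖inner ℂ (b i) x‖ ^ 2 := (b.sum_sq_norm_inner_right x).symm
  refine (sq_le_sq₀ (mul_nonneg (T.singularValues_nonneg _) (norm_nonneg _)) (norm_nonneg _)).1 ?_
  rw [mul_pow, h1, h2, Finset.mul_sum]
  refine Finset.sum_le_sum fun i _ => mul_le_mul_of_nonneg_right ?_ (sq_nonneg _)
  exact pow_le_pow_left₀ (T.singularValues_nonneg _)
    (T.singularValues_antitone (by have := i.2; omega)) 2

theorem singularValues_le_of_norm_le {T : E →ₗ[ℂ] F} (hT : ∀ x, ‖T x‖ ≤ ‖x‖)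
    (i : Fin (Module.finrank ℂ E)) : T.singularValues i ≤ 1 := by
  have hs := T.isSymmetric_adjoint_comp_self
  let b := hs.eigenvectorBasis rfl
  have h : T.singularValues i ^ 2 = ‖T (b i)‖ ^ 2 := by
    have h1 : inner ℂ (b i) ((LinearMap.adjoint T ∘ₗ T) (b i)) = (‖T (b i)‖ : ℂ) ^ 2 := by
      rw [LinearMap.comp_apply, LinearMap.adjoint_inner_right, inner_self_eq_norm_sq_to_K]
      rfl
    rw [hs.apply_eigenvectorBasis, inner_smul_right, inner_self_eq_norm_sq_to_K,
      OrthonormalBasis.norm_eq_one] at h1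
    rw [T.sq_singularValues_fin rfl]
    have := congrArg Complex.re h1
    norm_num at this
    norm_cast at this
  have h2 := hT (b i)
  rw [OrthonormalBasis.norm_eq_one] at h2
  nlinarith [T.singularValues_nonneg i, norm_nonneg (T (b i))]

/-- `‖sin Θ(U, V)‖_F²` is the sum of the squared distances to `U` of the vectors of any
orthonormal basis of `V`. -/
theorem frobNorm_sinTheta_sq {ι : Type*} [Fintype ι] (U V : Submodule ℂ E)
    (b : OrthonormalBasis ι ℂ V) :
    frobNorm (sinTheta U V) ^ 2 = ∑ i, ‖(b i : E) - U.starProjection (b i : E)‖ ^ 2 := by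
  set T : V →ₗ[ℂ] U := (U.orthogonalProjectionOnto : E →ₗ[ℂ] U) ∘ₗ V.subtype with hT
  have hT1 : ∀ x, ‖T x‖ ≤ ‖x‖ := fun x => U.norm_orthogonalProjectionOnto_apply_le (x : E)
  have h1 : frobNorm (sinTheta U V) ^ 2 =
      ∑ i : Fin (Module.finrank ℂ V), (1 - T.singularValues i ^ 2) := by
    rw [frobNorm_sq]
    refine Finset.sum_congr rfl fun i _ => ?_
    rw [Finset.sum_eq_single i]
    · have h0 := T.singularValues_nonneg i
      have h1 := singularValues_le_of_norm_le hT1 i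
      simp only [sinTheta, Matrix.diagonal_apply_eq, canonicalAngle, ← hT, Real.sin_arccos,
        Complex.norm_real, Real.norm_eq_abs, sq_abs]
      exact Real.sq_sqrt (by nlinarith)
    · intro j _ hj
      simp [sinTheta, Matrix.diagonal_apply_ne _ hj.symm]
    · simp
  have h2 : ∀ i, ‖(b i : E) - U.starProjection (b i : E)‖ ^ 2 = 1 - ‖T (b i)‖ ^ 2 := fun i => by
    have h := U.norm_sq_eq_add_norm_sq_projection (b i : E)
    have h3 : ‖(b i : E)‖ = 1 := b.norm_eq_one i
    have h4 : (b i : E) - U.starProjection (b i : E) = Uᗮ.starProjection (b i : E) := by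
      rw [Submodule.starProjection_orthogonal]
      simp
    rw [h3] at h
    rw [h4]
    change ‖Uᗮ.orthogonalProjectionOnto (b i : E)‖ ^ 2
      = 1 - ‖U.orthogonalProjectionOnto (b i : E)‖ ^ 2
    linarith
  rw [h1, Finset.sum_sub_distrib, sum_sq_singularValues T b, Finset.sum_congr rfl fun i _ => h2 i,
    Finset.sum_sub_distrib]
  simp [Module.finrank_eq_card_basis b.toBasis]

end SingularValues

section Stiefel

variable {ι κ : Type*} [Fintype ι] [Fintype κ] [DecidableEq κ]

theorem norm_toEuclideanLin_of_mem_stiefel {Q : Matrix ι κ ℂ} (hQ : Q ∈ Stiefel ι κ)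
    (x : EuclideanSpace ℂ κ) : ‖Matrix.toEuclideanLin Q x‖ = ‖x‖ := by
  have hQ' : Qᴴ * Q = 1 := hQ
  have h : (‖Matrix.toEuclideanLin Q x‖ : ℂ) ^ 2 = (‖x‖ : ℂ) ^ 2 := by
    have h1 := inner_self_eq_norm_sq_to_K (𝕜 := ℂ) (Matrix.toEuclideanLin Q x)
    have h2 := inner_self_eq_norm_sq_to_K (𝕜 := ℂ) x
    rw [EuclideanSpace.inner_eq_star_dotProduct] at h1 h2
    refine h1.symm.trans (Eq.trans ?_ h2)
    simp only [Matrix.toLpLin_apply]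
    rw [dotProduct_comm, Matrix.star_mulVec, ← Matrix.dotProduct_mulVec, Matrix.mulVec_mulVec,
      hQ', Matrix.one_mulVec, dotProduct_comm]
  have h' : ‖Matrix.toEuclideanLin Q x‖ ^ 2 = ‖x‖ ^ 2 := by exact_mod_cast h
  exact (sq_eq_sq₀ (norm_nonneg _) (norm_nonneg _)).1 h'

/-- The sines of the canonical angles between the column spaces of `Q` and `P` are at most the
distance between `Q` and `P`. -/
theorem frobNorm_sinTheta_colSpace_le {P Q : Matrix ι κ ℂ} (hP : P ∈ Stiefel ι κ) :
    frobNorm (sinTheta (colSpace Q) (colSpace P)) ^ 2 ≤ frobNorm (Q - P) ^ 2 := by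
  let L : EuclideanSpace ℂ κ →ₗᵢ[ℂ] EuclideanSpace ℂ ι :=
    ⟨Matrix.toEuclideanLin P, norm_toEuclideanLin_of_mem_stiefel hP⟩
  let b : OrthonormalBasis κ ℂ (colSpace P) := (EuclideanSpace.basisFun κ ℂ).map L.equivRange
  have hb : ∀ i, ((b i : colSpace P) : EuclideanSpace ℂ ι)
      = Matrix.toEuclideanLin P (EuclideanSpace.basisFun κ ℂ i) := fun i => rfl
  rw [frobNorm_sinTheta_sq _ _ b, frobNorm_sq, Finset.sum_comm]
  refine Finset.sum_le_sum fun i _ => ?_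
  rw [hb]
  set x := Matrix.toEuclideanLin P (EuclideanSpace.basisFun κ ℂ i)
  set y := Matrix.toEuclideanLin Q (EuclideanSpace.basisFun κ ℂ i) with hy
  have h1 : ‖x - (colSpace Q).starProjection x‖ ≤ ‖x - y‖ := by
    rw [Submodule.starProjection_minimal]
    exact ciInf_le ⟨0, by rintro _ ⟨z, rfl⟩; exact norm_nonneg _⟩
      (⟨y, LinearMap.mem_range_self _ _⟩ : colSpace Q)
  refine (pow_le_pow_left₀ (norm_nonneg _) h1 2).trans (le_of_eq ?_)
  rw [EuclideanSpace.norm_sq_eq]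
  refine Finset.sum_congr rfl fun a _ => ?_
  rw [← norm_neg]
  simp [x, y, Matrix.toLpLin_apply]

/-- If `X = Q Λ` is a polar decomposition, then `Λ ≥ σ_min(X)`. -/
theorem sigmaMin_mul_frobNorm_sq_le {X Q : Matrix ι κ ℂ} (hQ : Q ∈ Stiefel ι κ)
    {Λ : Matrix κ κ ℂ} (hΛ : Λ.PosSemidef) (hX : X = Q * Λ)
    (hcard : Fintype.card κ ≤ Fintype.card ι) (Y : Matrix ι κ ℂ) :
    sigmaMin X * frobNorm Y ^ 2 ≤ (Y * Λ * Yᴴ).trace.re := by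
  have hev : ∀ c, sigmaMin X ≤ hΛ.isHermitian.eigenvalues c := fun c => by
    have h := singularValues_last_mul_norm_le (Matrix.toEuclideanLin X)
      (hΛ.isHermitian.eigenvectorBasis c)
    rw [OrthonormalBasis.norm_eq_one, mul_one, finrank_euclideanSpace] at h
    have h2 : Matrix.toEuclideanLin X (hΛ.isHermitian.eigenvectorBasis c) =
        hΛ.isHermitian.eigenvalues c •
          Matrix.toEuclideanLin Q (hΛ.isHermitian.eigenvectorBasis c) := by
      rw [Matrix.toLpLin_apply, Matrix.toLpLin_apply, hX, ← Matrix.mulVec_mulVec,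
        hΛ.isHermitian.mulVec_eigenvectorBasis, Matrix.mulVec_smul, WithLp.toLp_smul]
    rw [h2, norm_smul, norm_toEuclideanLin_of_mem_stiefel hQ, OrthonormalBasis.norm_eq_one, mul_one,
      Real.norm_of_nonneg (hΛ.eigenvalues_nonneg c)] at h
    rwa [sigmaMin, min_eq_right hcard]
  set U : Matrix κ κ ℂ := (hΛ.isHermitian.eigenvectorUnitary : Matrix κ κ ℂ) with hU
  have hUU : U * Uᴴ = 1 := Unitary.coe_mul_star_self hΛ.isHermitian.eigenvectorUnitary
  have h1 : frobNorm Y ^ 2 = frobNorm (Y * U) ^ 2 := by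
    rw [← frobNorm_conjTranspose Y, ← frobNorm_conjTranspose (Y * U), frobNorm_sq_eq_trace,
      frobNorm_sq_eq_trace, Matrix.conjTranspose_mul, Matrix.conjTranspose_mul,
      Matrix.conjTranspose_conjTranspose, Matrix.conjTranspose_conjTranspose, Matrix.mul_assoc,
      ← Matrix.mul_assoc U, hUU, Matrix.one_mul]
  have h2 : (Y * Λ * Yᴴ).trace.re =
      ∑ a, ∑ c, hΛ.isHermitian.eigenvalues c * ‖(Y * U) a c‖ ^ 2 := by
    have hspec : Λ = U * Matrix.diagonal (fun c => (hΛ.isHermitian.eigenvalues c : ℂ)) * Uᴴ :=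
      hΛ.isHermitian.spectral_theorem
    have : Y * Λ * Yᴴ = (Y * U) *
        Matrix.diagonal (fun c => (hΛ.isHermitian.eigenvalues c : ℂ)) * (Y * U)ᴴ := by
      conv_lhs => rw [hspec]
      simp only [Matrix.conjTranspose_mul, Matrix.mul_assoc]
    rw [this, Matrix.trace, Complex.re_sum]
    refine Finset.sum_congr rfl fun a _ => ?_
    rw [Matrix.diag, Matrix.mul_apply, Complex.re_sum]
    refine Finset.sum_congr rfl fun c _ => ?_
    rw [Matrix.mul_diagonal, Matrix.conjTranspose_apply, mul_right_comm, Complex.star_def,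
      Complex.mul_conj']
    rw [mul_comm]
    norm_cast
  rw [h1, h2, frobNorm_sq, Finset.mul_sum]
  refine Finset.sum_le_sum fun a _ => ?_
  rw [Finset.mul_sum]
  exact Finset.sum_le_sum fun c _ => mul_le_mul_of_nonneg_right (hev c) (sq_nonneg _)

end Stiefel

/-! ### The objective as a quadratic form in one mode -/

section Objective

variable {m t : ℕ} {n : Fin m → ℕ} {κ : Fin m → Fin t → ℕ}

/-- The squared Frobenius norm of the block diagonal part is the sum over the diagonal blocks. -/
theorem tensorFrobNorm_bdiag_sq (ℓ : Fin m) (T : (∀ ℓ, Cols κ ℓ) → ℂ) :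
    tensorFrobNorm (bdiag T) ^ 2 =
      ∑ s : Fin t, ∑ b : ∀ i, Fin (κ i s), ‖T fun i => ⟨s, b i⟩‖ ^ 2 := by
  rw [tensorFrobNorm, Real.sq_sqrt (by positivity), ← Fintype.sum_sigma']
  refine (Fintype.sum_of_injective
    (fun p : Σ s : Fin t, ∀ i, Fin (κ i s) => (fun i => ⟨p.1, p.2 i⟩ : ∀ i, Cols κ i))
    ?_ _ _ ?_ ?_).symm
  · rintro ⟨s, b⟩ ⟨s', b'⟩ h
    obtain rfl : s = s' := congrArg Sigma.fst (congrFun h ℓ)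
    have : b = b' := funext fun i => by simpa using congrFun h i
    rw [this]
  · intro c hc
    have : ¬ ∃ s, ∀ i, (c i).1 = s := by
      rintro ⟨s, hs⟩
      refine hc ⟨⟨s, fun i => Fin.cast (by rw [hs i]) (c i).2⟩, funext fun i => ?_⟩
      have : ∀ (x : Cols κ i) (h : κ i x.1 = κ i s), x.1 = s →
          (⟨s, Fin.cast h x.2⟩ : Cols κ i) = x := by
        rintro ⟨s', b'⟩ h rfl
        rfl
      exact this (c i) (by rw [hs i]) (hs i)
    simp [bdiag, this]
  · rintro ⟨s, b⟩
    have : ∃ s', ∀ _ : Fin m, s = s' := ⟨s, fun _ => rfl⟩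
    change _ = ‖if ∃ s', ∀ _ : Fin m, s = s' then T fun i => ⟨s, b i⟩ else 0‖ ^ 2
    rw [if_pos this]

/-- A multi-mode product can be computed by multiplying along all the modes other than `ℓ` first,
and along the mode `ℓ` last. -/
theorem modeProd_eq_sum_unfolding {μ : Type*} [Fintype μ] [DecidableEq μ] {α β : μ → Type*}
    [∀ i, Fintype (β i)] (X : ∀ i, Matrix (α i) (β i) ℂ) (B : (∀ i, β i) → ℂ) (ℓ : μ)
    (c : ∀ i, α i) :
    modeProd X B c = ∑ a, X ℓ (c ℓ) a *
      modeProd (fun i : {i // i ≠ ℓ} => X i) (unfolding ℓ B a) (fun i => c i) := by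
  rw [modeProd, ← (Equiv.piSplitAt ℓ β).symm.sum_comp, Fintype.sum_prod_type]
  refine Finset.sum_congr rfl fun a _ => ?_
  rw [modeProd, Finset.mul_sum]
  refine Finset.sum_congr rfl fun x _ => ?_
  rw [Fintype.prod_eq_mul_prod_subtype_ne
    (fun i => X i (c i) ((Equiv.piSplitAt ℓ β).symm (a, x) i)) ℓ, mul_assoc]
  congr 1
  · simp [Equiv.piSplitAt]
  · congr 1
    refine Finset.prod_congr rfl fun i _ => ?_
    simp [Equiv.piSplitAt, i.2]

theorem objective_eq_sum_block (B : Tensor n) (P : Tuple n κ) (ℓ : Fin m) :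
    objective B P = ∑ s, frobNorm ((block (P ℓ) s)ᴴ * matC B P ℓ s) ^ 2 := by
  rw [objective, tensorFrobNorm_bdiag_sq ℓ]
  refine Finset.sum_congr rfl fun s _ => ?_
  rw [frobNorm_sq, ← (Equiv.piSplitAt ℓ fun i => Fin (κ i s)).symm.sum_comp,
    Fintype.sum_prod_type]
  refine Finset.sum_congr rfl fun b _ => Finset.sum_congr rfl fun y _ => ?_
  rw [modeProd_eq_sum_unfolding _ _ ℓ, Matrix.mul_apply]
  congr 2
  refine Finset.sum_congr rfl fun a _ => ?_
  congr 1
  · simp [Equiv.piSplitAt, block]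
  · simp only [matC, Matrix.of_apply, modeProd]
    refine Finset.sum_congr rfl fun x _ => ?_
    congr 1
    refine Finset.prod_congr rfl fun i _ => ?_
    simp [Equiv.piSplitAt, block, i.2]

/-- For fixed `C₁, …, C_t` the linear map `X = [X₁, …, X_t] ↦ [C₁ C₁ᴴ X₁, …, C_t C_tᴴ X_t]` is the
gradient of the convex quadratic form `½ ∑ₛ ‖Xₛᴴ Cₛ‖_F²`, which therefore lies above its
tangents. -/
theorem two_mul_trace_le_sum_block {ℓ : Fin m} {γ : Fin t → Type*} [∀ s, Fintype (γ s)]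
    (C : ∀ s, Matrix (Fin (n ℓ)) (γ s) ℂ) (X Y : Matrix (Fin (n ℓ)) (Cols κ ℓ) ℂ) :
    2 * ((Y - X)ᴴ * Matrix.of fun a (c : Cols κ ℓ) => (C c.1 * (C c.1)ᴴ * block X c.1) a c.2).trace.re ≤
      ∑ s, frobNorm ((block Y s)ᴴ * C s) ^ 2 - ∑ s, frobNorm ((block X s)ᴴ * C s) ^ 2 := by
  have h1 : ((Y - X)ᴴ * Matrix.of fun a (c : Cols κ ℓ) => (C c.1 * (C c.1)ᴴ * block X c.1) a c.2).trace =
      ∑ s, ((block (Y - X) s)ᴴ * (C s * (C s)ᴴ * block X s)).trace := by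
    simp only [Matrix.trace, Matrix.diag, Fintype.sum_sigma, Matrix.mul_apply (M := (Y - X)ᴴ),
      Matrix.mul_apply (M := (block _ _)ᴴ)]
    rfl
  rw [h1, Complex.re_sum, Finset.mul_sum, ← Finset.sum_sub_distrib]
  refine Finset.sum_le_sum fun s _ => ?_
  set U := (C s)ᴴ * block X s with hU
  set V := (C s)ᴴ * block Y s with hV
  have h2 : ∀ Z : Matrix (Fin (n ℓ)) (Cols κ ℓ) ℂ,
      frobNorm ((block Z s)ᴴ * C s) = frobNorm ((C s)ᴴ * block Z s) := fun Z => by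
    rw [← frobNorm_conjTranspose]
    simp [Matrix.conjTranspose_mul]
  have h3 : (block (Y - X) s)ᴴ * (C s * (C s)ᴴ * block X s) = (V - U)ᴴ * U := by
    have : block (Y - X) s = block Y s - block X s := rfl
    rw [this, hU, hV, ← Matrix.mul_sub, Matrix.conjTranspose_mul, Matrix.conjTranspose_conjTranspose]
    simp only [Matrix.mul_assoc]
  have h4 : frobNorm V ^ 2 - frobNorm U ^ 2 =
      2 * ((V - U)ᴴ * U).trace.re + frobNorm (V - U) ^ 2 := by
    have h5 : (Uᴴ * V).trace.re = (Vᴴ * U).trace.re := by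
      have : (Uᴴ * V)ᴴ.trace = (Vᴴ * U).trace := by simp [Matrix.conjTranspose_mul]
      rw [← this, Matrix.trace_conjTranspose, Complex.star_def, Complex.conj_re]
    simp only [frobNorm_sq_eq_trace, Matrix.conjTranspose_sub, Matrix.sub_mul, Matrix.mul_sub,
      Matrix.trace_sub, Complex.sub_re, h5]
    ring
  rw [h2, h2, ← hU, ← hV, h3, h4]
  linarith [sq_nonneg (frobNorm (V - U))]

theorem matC_congr (B : Tensor n) {P P' : Tuple n κ} {ℓ : Fin m} (h : ∀ i, i ≠ ℓ → P' i = P i)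
    (s : Fin t) : matC B P' ℓ s = matC B P ℓ s := by
  have : (fun i : {i // i ≠ ℓ} => (block (P' i) s)ᴴ) =
      fun i : {i // i ≠ ℓ} => (block (P i) s)ᴴ :=
    funext fun i => by rw [h i i.2]
  unfold matC
  rw [this]

/-- Replacing the `ℓ`-th matrix by a polar factor of the partial gradient increases the objective
by at least `tr ((P'_ℓ - P_ℓ) Λ (P'_ℓ - P_ℓ)ᴴ)`. -/
theorem trace_le_objective_sub (B : Tensor n) {P P' : Tuple n κ} {ℓ : Fin m}
    (h : ∀ i, i ≠ ℓ → P' i = P i) (hP : P ℓ ∈ Stiefel _ _) (hP' : P' ℓ ∈ Stiefel _ _)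
    {Λ : Matrix (Cols κ ℓ) (Cols κ ℓ) ℂ} (hΛ : Λ.IsHermitian)
    (hG : partialGrad B P ℓ = P' ℓ * Λ) :
    ((P' ℓ - P ℓ) * Λ * (P' ℓ - P ℓ)ᴴ).trace.re ≤ objective B P' - objective B P := by
  rw [trace_gap hP hP' hΛ, ← hG, objective_eq_sum_block B P ℓ, objective_eq_sum_block B P' ℓ]
  simp only [matC_congr B h]
  exact two_mul_trace_le_sum_block (matC B P ℓ) (P ℓ) (P' ℓ)

end Objective

/-! ### Continuity and compactness -/

section Topology

variable {m t : ℕ} {n : Fin m → ℕ} {κ : Fin m → Fin t → ℕ}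

theorem continuous_partialGrad (B : Tensor n) (ℓ : Fin m) :
    Continuous fun P : Tuple n κ => partialGrad B P ℓ := by
  have hC : ∀ s, Continuous fun P : Tuple n κ => matC B P ℓ s := fun s => by
    refine continuous_matrix fun a y => ?_
    simp only [matC, Matrix.of_apply, modeProd, block, Matrix.conjTranspose_apply,
      Matrix.submatrix_apply]
    refine continuous_finsetSum _ fun x _ => (continuous_finsetProd _ fun i _ => ?_).mul
      continuous_const
    exact (Continuous.matrix_elem (A := fun P : Tuple n κ => P i) (continuous_apply _) _ _).star
  refine continuous_matrix fun a c => ?_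
  have h : Continuous fun P : Tuple n κ => matH B P ℓ c.1 * block (P ℓ) c.1 :=
    ((hC c.1).matrix_mul (hC c.1).matrix_conjTranspose).matrix_mul
      ((continuous_apply ℓ).matrix_submatrix _ _)
  exact h.matrix_elem _ _

theorem continuous_objective (B : Tensor n) :
    Continuous fun P : Tuple n κ => objective B P := by
  unfold objective tensorFrobNorm
  refine (Real.continuous_sqrt.comp (continuous_finsetSum _ fun c _ => ?_)).pow 2
  refine Continuous.pow (Continuous.norm ?_) 2
  unfold bdiag
  split_ifs
  · unfold modeProd
    refine continuous_finsetSum _ fun x _ => (continuous_finsetProd _ fun i _ => ?_).mul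
      continuous_const
    exact (Continuous.matrix_elem (A := fun P : Tuple n κ => P i) (continuous_apply _) _ _).star
  · exact continuous_const

theorem isCompact_stiefel {ι κ : Type*} [Fintype ι] [Fintype κ] [DecidableEq κ] :
    IsCompact (Stiefel ι κ) := by
  have hK : IsCompact (Set.univ.pi fun _ : ι => Set.univ.pi fun _ : κ =>
      Metric.closedBall (0 : ℂ) 1) :=
    isCompact_univ_pi fun _ => isCompact_univ_pi fun _ => isCompact_closedBall 0 1
  have hc : IsClosed (Stiefel ι κ) :=
    isClosed_eq (continuous_id.matrix_conjTranspose.matrix_mul continuous_id) continuous_const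
  refine IsCompact.of_isClosed_subset hK hc fun P hP i _ j _ => ?_
  have hP' : (Pᴴ * P) j j = 1 := by rw [show Pᴴ * P = 1 from hP, Matrix.one_apply_eq]
  have h1 : ∑ a, ‖P a j‖ ^ 2 = 1 := by
    rw [Matrix.mul_apply] at hP'
    have h2 : ∑ a, (‖P a j‖ ^ 2 : ℂ) = 1 := by
      rw [← hP']
      refine Finset.sum_congr rfl fun a _ => ?_
      rw [Matrix.conjTranspose_apply, Complex.star_def, Complex.conj_mul']
    exact_mod_cast h2
  have h3 : ‖P i j‖ ^ 2 ≤ 1 :=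
    h1 ▸ Finset.single_le_sum (f := fun a => ‖P a j‖ ^ 2) (fun _ _ => by positivity)
      (Finset.mem_univ i)
  rw [mem_closedBall_zero_iff]
  nlinarith [norm_nonneg (P i j)]

theorem isClosed_posSemidef {κ : Type*} [Fintype κ] :
    IsClosed {Λ : Matrix κ κ ℂ | Λ.PosSemidef} := by
  have := Complex.orderClosedTopology
  simp only [Matrix.posSemidef_iff_dotProduct_mulVec, Set.ofPred_and, Set.ofPred_forall]
  refine IsClosed.inter (isClosed_eq continuous_id.matrix_conjTranspose continuous_id)
    (isClosed_iInter fun x => isClosed_le continuous_const ?_)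
  exact continuous_const.dotProduct (continuous_id.matrix_mulVec continuous_const)

/-- If the sequence `u` stays in a compact set, `a` is an isolated accumulation point of `u`, and
`u (j + 1)` tends to `a` whenever `u j` does, then the whole sequence converges to `a`. -/
theorem IsIsolatedAccumulationPoint.tendsto {X : Type*} [TopologicalSpace X] [T2Space X]
    [RegularSpace X]
    {K : Set X} (hK : IsCompact K) {u : ℕ → X} (hu : ∀ j, u j ∈ K) {a : X}
    (ha : IsIsolatedAccumulationPoint u a)
    (hstep : ∀ 𝒰 : Ultrafilter ℕ, ↑𝒰 ≤ (atTop : Filter ℕ) → Tendsto u 𝒰 (𝓝 a) →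
      Tendsto (fun j => u (j + 1)) 𝒰 (𝓝 a)) :
    Tendsto u atTop (𝓝 a) := by
  obtain ⟨hacc, U, hU, hiso⟩ := ha
  obtain ⟨V, ⟨haV, hVc⟩, hVU⟩ := (closed_nhds_basis a).mem_iff.1 hU
  -- along the indices `j` with `u j ∈ V` the sequence can only accumulate at `a`
  have h1 : Tendsto u (atTop ⊓ 𝓟 {j | u j ∈ V}) (𝓝 a) := by
    refine tendsto_iff_ultrafilter _ _ _ |>.2 fun 𝒰 h𝒰 => ?_
    obtain ⟨b, -, hb⟩ := hK.ultrafilter_le_nhds (𝒰.map u)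
      (le_principal_iff.2 (Filter.Eventually.of_forall (f := (𝒰 : Filter ℕ)) hu))
    have hbV : b ∈ V := hVc.mem_of_tendsto (b := (𝒰 : Filter ℕ)) hb
      (le_principal_iff.1 (h𝒰.trans inf_le_right))
    rwa [hiso b (hVU hbV) (mapClusterPt_iff_ultrafilter.2 ⟨𝒰, h𝒰.trans inf_le_left, hb⟩)] at hb
  have h2 : Tendsto (fun j => u (j + 1)) (atTop ⊓ 𝓟 {j | u j ∈ V}) (𝓝 a) :=
    tendsto_iff_ultrafilter _ _ _ |>.2 fun 𝒰 h𝒰 =>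
      hstep 𝒰 (h𝒰.trans inf_le_left) (h1.mono_left h𝒰)
  have h3 : ∀ᶠ j in atTop, u j ∈ V → u (j + 1) ∈ V :=
    eventually_inf_principal.1 (h2.eventually haV)
  obtain ⟨N, hN⟩ := eventually_atTop.1 h3
  obtain ⟨j₀, hj₀, hj₀V⟩ := (frequently_atTop.1 (hacc.frequently haV)) N
  have h4 : ∀ᶠ j in atTop, u j ∈ V := by
    refine eventually_atTop.2 ⟨j₀, fun j hj => ?_⟩
    induction j, hj using Nat.le_induction with
    | base => exact hj₀V
    | succ j hj ih => exact hN j (hj₀.trans hj) ih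
  exact h1.mono_left (le_inf le_rfl (le_principal_iff.2 h4))

end Topology

/-! ### The increase of the objective in one sweep -/

section Sweep

theorem IsPolarFactor.posSemidef {ι κ : Type*} [Fintype ι] [Fintype κ] [DecidableEq κ]
    {X Q : Matrix ι κ ℂ} (h : IsPolarFactor X Q) : (Qᴴ * X).PosSemidef ∧ X = Q * (Qᴴ * X) := by
  obtain ⟨hQ, Λ, hΛ, rfl⟩ := h
  have hQ' : Qᴴ * Q = 1 := hQ
  rw [← Matrix.mul_assoc, hQ', Matrix.one_mul]
  exact ⟨hΛ, rfl⟩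

variable {m t : ℕ} {n : Fin m → ℕ} {κ : Fin m → Fin t → ℕ}

/-- The lower bound `tr ((P'_ℓ - P_ℓ) Λ_ℓ (P'_ℓ - P_ℓ)ᴴ)`, with `Λ_ℓ = P'_ℓᴴ ℋ̂_ℓ`, for the
increase of the objective in the `ℓ`-th update of the sweep that leads from `P` to `P'`. -/
noncomputable def stepGap (B : Tensor n) (P' P : Tuple n κ) (ℓ : Fin m) : ℝ :=
  ((P' ℓ - P ℓ) * ((P' ℓ)ᴴ * partialGrad B (gsMix P' P ℓ) ℓ) * (P' ℓ - P ℓ)ᴴ).trace.re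

theorem stepGap_nonneg {B : Tensor n} {P' P : Tuple n κ} {ℓ : Fin m}
    (h : IsPolarFactor (partialGrad B (gsMix P' P ℓ) ℓ) (P' ℓ)) : 0 ≤ stepGap B P' P ℓ :=
  trace_mul_posSemidef_mul_nonneg h.posSemidef.1 _

theorem sum_stepGap_le {B : Tensor n} {P' P : Tuple n κ}
    (hP : ∀ ℓ, P ℓ ∈ Stiefel (Fin (n ℓ)) (Cols κ ℓ))
    (h : ∀ ℓ, IsPolarFactor (partialGrad B (gsMix P' P ℓ) ℓ) (P' ℓ)) :
    ∑ ℓ, stepGap B P' P ℓ ≤ objective B P' - objective B P := by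
  -- `Q r` is the tuple after the first `r` updates, so `Q ℓ` is `gsMix P' P ℓ`
  let Q : ℕ → Tuple n κ := fun r i => if (i : ℕ) < r then P' i else P i
  have h0 : Q 0 = P := funext fun i => if_neg (Nat.not_lt_zero _)
  have hm : Q m = P' := funext fun i => if_pos i.2
  have hsum := Finset.sum_range_sub (fun r => objective B (Q r)) m
  rw [h0, hm, ← Fin.sum_univ_eq_sum_range
    (fun r => objective B (Q (r + 1)) - objective B (Q r))] at hsum
  rw [← hsum]
  refine Finset.sum_le_sum fun ℓ _ => ?_
  have h1 : Q (ℓ + 1) ℓ = P' ℓ := if_pos (Nat.lt_succ_self _)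
  have h2 : Q ℓ ℓ = P ℓ := if_neg (lt_irrefl _)
  have h3 : ∀ i, i ≠ ℓ → Q (ℓ + 1) i = Q ℓ i := fun i hi => by
    have : (i : ℕ) ≠ ℓ := fun h => hi (Fin.ext h)
    have h4 : (i : ℕ) < ℓ + 1 ↔ (i : ℕ) < ℓ := by omega
    simp only [Q, h4]
  have := trace_le_objective_sub B h3 (h2 ▸ hP ℓ) (h1 ▸ (h ℓ).1)
    (h ℓ).posSemidef.1.isHermitian (h1 ▸ (h ℓ).posSemidef.2)
  rwa [h1, h2] at this

theorem continuous_gsMix (ℓ : Fin m) :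
    Continuous fun p : Tuple n κ × Tuple n κ => gsMix p.1 p.2 ℓ := by
  refine continuous_pi fun i => ?_
  unfold gsMix
  split_ifs
  · exact (continuous_apply i).comp continuous_fst
  · exact (continuous_apply i).comp continuous_snd

theorem continuous_stepGap (B : Tensor n) (ℓ : Fin m) :
    Continuous fun p : Tuple n κ × Tuple n κ => stepGap B p.1 p.2 ℓ := by
  have h1 : Continuous fun p : Tuple n κ × Tuple n κ => p.1 ℓ :=
    (continuous_apply ℓ).comp continuous_fst
  have h2 : Continuous fun p : Tuple n κ × Tuple n κ => p.2 ℓ :=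
    (continuous_apply ℓ).comp continuous_snd
  have hG := (continuous_partialGrad B ℓ).comp (continuous_gsMix (n := n) (κ := κ) ℓ)
  exact Complex.continuous_re.comp (((h1.sub h2).matrix_mul
    (h1.matrix_conjTranspose.matrix_mul hG)).matrix_mul
    (h1.sub h2).matrix_conjTranspose).matrix_trace

theorem gsMix_eq_right {P' P : Tuple n κ} {ℓ : Fin m} (h : ∀ i < ℓ, P' i = P i) :
    gsMix P' P ℓ = P :=
  funext fun i => by
    unfold gsMix
    split_ifs with hi
    exacts [h i hi, rfl]

end Sweep

/-! ### Convergence -/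

section Convergence

variable {m t : ℕ} {n : Fin m → ℕ} {κ : Fin m → Fin t → ℕ} {B : Tensor n} {P : ℕ → Tuple n κ}

theorem IsNPDoSequence.mem_stiefel (hP : IsNPDoSequence B P) (j : ℕ) (ℓ : Fin m) :
    P j ℓ ∈ Stiefel (Fin (n ℓ)) (Cols κ ℓ) := by
  cases j with
  | zero => exact hP.1 ℓ
  | succ j => exact (hP.2 j ℓ).1

theorem isCompact_pi_stiefel :
    IsCompact (Set.univ.pi fun ℓ => Stiefel (Fin (n ℓ)) (Cols κ ℓ)) :=
  isCompact_univ_pi fun _ => isCompact_stiefel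

theorem IsNPDoSequence.mem_pi (hP : IsNPDoSequence B P) (j : ℕ) :
    P j ∈ Set.univ.pi fun ℓ => Stiefel (Fin (n ℓ)) (Cols κ ℓ) :=
  fun ℓ _ => hP.mem_stiefel j ℓ

theorem IsNPDoSequence.stepGap_le (hP : IsNPDoSequence B P) (j : ℕ) (ℓ : Fin m) :
    stepGap B (P (j + 1)) (P j) ℓ ≤ objective B (P (j + 1)) - objective B (P j) :=
  (Finset.single_le_sum (f := stepGap B (P (j + 1)) (P j))
    (fun i _ => stepGap_nonneg (hP.2 j i)) (Finset.mem_univ ℓ)).trans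
    (sum_stepGap_le (hP.mem_stiefel j) (hP.2 j))

theorem IsNPDoSequence.monotone (hP : IsNPDoSequence B P) :
    Monotone fun j => objective B (P j) :=
  monotone_nat_of_le_succ fun j => sub_nonneg.1 <|
    (Finset.sum_nonneg fun i _ => stepGap_nonneg (hP.2 j i)).trans
      (sum_stepGap_le (hP.mem_stiefel j) (hP.2 j))

theorem IsNPDoSequence.exists_objective_le (hP : IsNPDoSequence B P) :
    ∃ M, ∀ j, objective B (P j) ≤ M := by
  obtain ⟨M, hM⟩ := isCompact_pi_stiefel.bddAbove_image (continuous_objective B).continuousOn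
  exact ⟨M, fun j => hM ⟨P j, hP.mem_pi j, rfl⟩⟩

theorem IsNPDoSequence.summable_stepGap (hP : IsNPDoSequence B P) (ℓ : Fin m) :
    Summable fun j => stepGap B (P (j + 1)) (P j) ℓ := by
  obtain ⟨M, hM⟩ := hP.exists_objective_le
  refine summable_of_sum_range_le (c := M - objective B (P 0))
    (fun j => stepGap_nonneg (hP.2 j ℓ)) fun N => ?_
  calc _ ≤ ∑ j ∈ Finset.range N, (objective B (P (j + 1)) - objective B (P j)) :=
        Finset.sum_le_sum fun j _ => hP.stepGap_le j ℓ
    _ = objective B (P N) - objective B (P 0) :=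
        Finset.sum_range_sub (fun j => objective B (P j)) N
    _ ≤ _ := sub_le_sub_right (hM N) _

theorem tendsto_matrix_mul {ι κ μ : Type*} [Fintype κ] {X : ℕ → Matrix ι κ ℂ}
    {Y : ℕ → Matrix κ μ ℂ} {X' : Matrix ι κ ℂ} {Y' : Matrix κ μ ℂ} {F : Filter ℕ}
    (hX : Tendsto X F (𝓝 X')) (hY : Tendsto Y F (𝓝 Y')) :
    Tendsto (fun j => X j * Y j) F (𝓝 (X' * Y')) := by
  refine tendsto_pi_nhds.2 fun i => tendsto_pi_nhds.2 fun k => ?_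
  exact tendsto_finsetSum _ fun a _ => (tendsto_pi_nhds.1 (tendsto_pi_nhds.1 hX i) a).mul
    (tendsto_pi_nhds.1 (tendsto_pi_nhds.1 hY a) k)

theorem tendsto_conjTranspose {ι κ : Type*} {X : ℕ → Matrix ι κ ℂ} {X' : Matrix ι κ ℂ}
    {F : Filter ℕ} (hX : Tendsto X F (𝓝 X')) : Tendsto (fun j => (X j)ᴴ) F (𝓝 X'ᴴ) := by
  refine tendsto_pi_nhds.2 fun i => tendsto_pi_nhds.2 fun k => ?_
  exact (tendsto_pi_nhds.1 (tendsto_pi_nhds.1 hX k) i).star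

theorem tendsto_of_continuous_uncurried {X Y Z : Type*} [TopologicalSpace X] [TopologicalSpace Y]
    [TopologicalSpace Z] {f : X → Y → Z} (hf : Continuous fun p : X × Y => f p.1 p.2)
    {F : Filter ℕ} {x : ℕ → X} {y : ℕ → Y} {a : X} {b : Y} (hx : Tendsto x F (𝓝 a))
    (hy : Tendsto y F (𝓝 b)) : Tendsto (fun j => f (x j) (y j)) F (𝓝 (f a b)) :=
  (hf.tendsto (a, b)).comp (hx.prodMk_nhds hy)

theorem posSemidef_of_tendsto {ι κ : Type*} [Fintype ι] [Fintype κ] {X Q : ℕ → Matrix ι κ ℂ}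
    {X' Q' : Matrix ι κ ℂ} {F : Filter ℕ} [F.NeBot] (hQ : Tendsto Q F (𝓝 Q'))
    (hX : Tendsto X F (𝓝 X'))
    (h : ∀ j, ((Q j)ᴴ * X j).PosSemidef ∧ X j = Q j * ((Q j)ᴴ * X j)) :
    (Q'ᴴ * X').PosSemidef ∧ X' = Q' * (Q'ᴴ * X') := by
  have hΛ := tendsto_matrix_mul (tendsto_conjTranspose hQ) hX
  exact ⟨isClosed_posSemidef.mem_of_tendsto hΛ (Filter.Eventually.of_forall fun j => (h j).1),
    tendsto_nhds_unique hX ((tendsto_matrix_mul hQ hΛ).congr fun j => (h j).2.symm)⟩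

/-- In the limit the gap vanishes, so that `P*` and the limit `Q` of the next iterates are both
orthonormal polar factors of the limit of `ℋ̂_ℓ`, with the same Hermitian factor. -/
theorem IsNPDoSequence.exists_polar_of_tendsto (hP : IsNPDoSequence B P) {𝒰 : Filter ℕ} [𝒰.NeBot]
    (h𝒰 : 𝒰 ≤ atTop) {Ps Q : Tuple n κ} (hPs : Tendsto P 𝒰 (𝓝 Ps))
    (hQ : Tendsto (fun j => P (j + 1)) 𝒰 (𝓝 Q)) (ℓ : Fin m) :
    Ps ℓ ∈ Stiefel (Fin (n ℓ)) (Cols κ ℓ) ∧ ∃ Λ : Matrix (Cols κ ℓ) (Cols κ ℓ) ℂ, Λ.PosSemidef ∧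
      partialGrad B (gsMix Q Ps ℓ) ℓ = Q ℓ * Λ ∧ partialGrad B (gsMix Q Ps ℓ) ℓ = Ps ℓ * Λ := by
  set G := partialGrad B (gsMix Q Ps ℓ) ℓ
  have hG : Tendsto (fun j => hatGrad B P j ℓ) 𝒰 (𝓝 G) :=
    tendsto_of_continuous_uncurried (f := fun Q P : Tuple n κ => partialGrad B (gsMix Q P ℓ) ℓ)
      ((continuous_partialGrad B ℓ).comp (continuous_gsMix ℓ)) hQ hPs
  have hgap : stepGap B Q Ps ℓ = 0 :=
    tendsto_nhds_unique (tendsto_of_continuous_uncurried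
      (f := fun Q P : Tuple n κ => stepGap B Q P ℓ) (continuous_stepGap B ℓ) hQ hPs)
      ((hP.summable_stepGap ℓ).tendsto_atTop_zero.mono_left h𝒰)
  have hgap' : ((Q ℓ - Ps ℓ) * ((Q ℓ)ᴴ * G) * (Q ℓ - Ps ℓ)ᴴ).trace.re = 0 := hgap
  clear_value G
  have hQℓ : Tendsto (fun j => P (j + 1) ℓ) 𝒰 (𝓝 (Q ℓ)) := (tendsto_pi_nhds.1 hQ) ℓ
  obtain ⟨hpsd, hQG⟩ := posSemidef_of_tendsto hQℓ hG fun j => (hP.2 j ℓ).posSemidef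
  have h0 := mul_eq_zero_of_trace_eq_zero hpsd hgap'
  rw [Matrix.sub_mul, sub_eq_zero] at h0
  refine ⟨?_, _, hpsd, hQG, hQG.trans h0⟩
  exact isCompact_stiefel.isClosed.mem_of_tendsto ((tendsto_pi_nhds.1 hPs) ℓ)
    (Filter.Eventually.of_forall fun j => hP.mem_stiefel j ℓ)

theorem eq_of_mul_eq_mul_of_rank {ι κ : Type*} [Fintype ι] [Fintype κ] [DecidableEq κ]
    {X Q Q' : Matrix ι κ ℂ} {Λ : Matrix κ κ ℂ} (h : X = Q * Λ) (h' : X = Q' * Λ)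
    (hX : X.rank = Fintype.card κ) : Q = Q' := by
  have hr : Λ.rank = Fintype.card κ :=
    le_antisymm Λ.rank_le_card_width (hX ▸ h ▸ Matrix.rank_mul_le_right Q Λ)
  have hu : IsUnit Λ := by
    have h1 : LinearMap.range Λ.mulVecLin = ⊤ :=
      Submodule.eq_top_of_finrank_eq (hr.trans (Module.finrank_fintype_fun_eq_card ℂ).symm)
    exact Matrix.mulVec_surjective_iff_isUnit.1 (LinearMap.range_eq_top.1 h1)
  obtain ⟨u, rfl⟩ := hu
  have := congrArg (· * (↑u⁻¹ : Matrix κ κ ℂ)) (h.symm.trans h')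
  simpa [Matrix.mul_assoc, ← Units.val_mul] using this

/-- Up to the first mode with a rank-deficient gradient, `P*` and the limit `Q` of the next iterates
agree: the agreement in the modes before `ℓ` turns the mixed gradient of mode `ℓ` into the gradient
at `P*`. -/
theorem IsNPDoSequence.limits_eq_of_rank (hP : IsNPDoSequence B P) {𝒰 : Filter ℕ} [𝒰.NeBot]
    (h𝒰 : 𝒰 ≤ atTop) {Ps Q : Tuple n κ} (hPs : Tendsto P 𝒰 (𝓝 Ps))
    (hQ : Tendsto (fun j => P (j + 1)) 𝒰 (𝓝 Q)) {r : ℕ}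
    (hr : ∀ ℓ : Fin m, (ℓ : ℕ) < r → (partialGrad B Ps ℓ).rank = ∑ s, κ ℓ s)
    (ℓ : Fin m) (hℓ : (ℓ : ℕ) < r) : Q ℓ = Ps ℓ := by
  induction ℓ using WellFoundedLT.induction with
  | ind ℓ ih =>
    obtain ⟨-, Λ, -, h1, h2⟩ := hP.exists_polar_of_tendsto h𝒰 hPs hQ ℓ
    rw [gsMix_eq_right fun i hi => ih i hi (lt_trans hi hℓ)] at h1 h2
    exact eq_of_mul_eq_mul_of_rank h1 h2 (by simpa using hr ℓ hℓ)

theorem IsPolarKKT.isKKT {P : Tuple n κ} (h : IsPolarKKT B P) : IsKKT B P :=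
  fun ℓ => ⟨(h ℓ).1, _, (h ℓ).2.2.isHermitian, (h ℓ).2.1⟩

theorem IsNPDoSequence.tendsto_of_isIsolated (hP : IsNPDoSequence B P) {Ps : Tuple n κ}
    (hiso : IsIsolatedAccumulationPoint P Ps)
    (hr : ∀ ℓ, (partialGrad B Ps ℓ).rank = ∑ s, κ ℓ s) : Tendsto P atTop (𝓝 Ps) := by
  refine hiso.tendsto isCompact_pi_stiefel hP.mem_pi fun 𝒰 h𝒰 hPs => ?_
  obtain ⟨Q, -, hQ⟩ := isCompact_pi_stiefel.ultrafilter_le_nhds (𝒰.map fun j => P (j + 1))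
    (le_principal_iff.2 (Filter.Eventually.of_forall (f := (𝒰 : Filter ℕ))
      fun j => hP.mem_pi (j + 1)))
  have : Q = Ps := funext fun ℓ =>
    hP.limits_eq_of_rank h𝒰 hPs hQ (r := m) (fun ℓ _ => hr ℓ) ℓ ℓ.2
  exact this ▸ hQ

theorem IsNPDoSequence.sigmaMin_mul_le_stepGap (hP : IsNPDoSequence B P)
    (hn : ∀ ℓ, ∑ s, κ ℓ s ≤ n ℓ) (j : ℕ) (ℓ : Fin m) :
    sigmaMin (hatGrad B P j ℓ) * frobNorm (P (j + 1) ℓ - P j ℓ) ^ 2 ≤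
      stepGap B (P (j + 1)) (P j) ℓ :=
  sigmaMin_mul_frobNorm_sq_le (hP.2 j ℓ).1 (hP.2 j ℓ).posSemidef.1 (hP.2 j ℓ).posSemidef.2
    (by simpa using hn ℓ) _

/-- The normalized residual of `P` in the equation `X = P (Pᴴ X)` is bounded by the distance from
`P` to a polar factor of `X`. -/
theorem IsPolarFactor.residual_le {ι κ : Type*} [Fintype ι] [Fintype κ] [DecidableEq κ]
    {X Q P : Matrix ι κ ℂ} (h : IsPolarFactor X Q) (hP : P ∈ Stiefel ι κ) :
    frobNorm (X - P * (Pᴴ * X)) ^ 2 / frobNorm X ^ 2 ≤ frobNorm (Q - P) ^ 2 := by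
  obtain ⟨hQ, Λ, -, rfl⟩ := h
  have hP' : Pᴴ * P = 1 := hP
  have h1 : Q * Λ - P * (Pᴴ * (Q * Λ)) = (Q - P) * Λ - P * (Pᴴ * ((Q - P) * Λ)) := by
    have : P * (Pᴴ * (P * Λ)) = P * Λ := by rw [← Matrix.mul_assoc Pᴴ, hP', Matrix.one_mul]
    rw [Matrix.sub_mul, Matrix.mul_sub, Matrix.mul_sub, this]
    abel
  have h2 : frobNorm (Q * Λ - P * (Pᴴ * (Q * Λ))) ≤ frobNorm (Q - P) * frobNorm (Q * Λ) := by
    rw [h1, frobNorm_mul_of_mem_stiefel hQ]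
    exact (frobNorm_sub_proj_le hP _).trans (frobNorm_mul_le _ _)
  -- for `Q * Λ = 0` the quotient is `0`
  refine div_le_of_le_mul₀ (sq_nonneg _) (sq_nonneg _) ?_
  rw [← mul_pow]
  exact pow_le_pow_left₀ (frobNorm_nonneg _) h2 2

end Convergence

end PTBD

theorem mainTheorem1
    {m t : ℕ} (hm : 1 ≤ m) (ht : 1 ≤ t)
    (n : Fin m → ℕ) (κ : Fin m → Fin t → ℕ)
    (hκ : ∀ ℓ s, 1 ≤ κ ℓ s) (hn : ∀ ℓ, ∑ s, κ ℓ s ≤ n ℓ)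
    (B : PTBD.Tensor n) (P : ℕ → PTBD.Tuple n κ) (hP : PTBD.IsNPDoSequence B P) :
    -- (a)
    (Monotone (fun j => PTBD.objective B (P j)) ∧
      ∃ L : ℝ, Tendsto (fun j => PTBD.objective B (P j)) atTop (𝓝 L)) ∧
    -- (b) and (c)
    (∀ (Ps : PTBD.Tuple n κ) (φ : ℕ → ℕ) (Ph : PTBD.HeadTuple n κ),
      StrictMono φ → Tendsto (fun i => P (φ i)) atTop (𝓝 Ps) →
      PTBD.IsAccumulationPoint
        (fun i => (fun ℓ => P (φ i + 1) ℓ.1 : PTBD.HeadTuple n κ)) Ph →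
      (∀ ℓ, PTBD.partialGrad B (PTBD.gsMixHead Ph Ps ℓ) ℓ =
            Ps ℓ * ((Ps ℓ)ᴴ * PTBD.partialGrad B (PTBD.gsMixHead Ph Ps ℓ) ℓ) ∧
          ((Ps ℓ)ᴴ * PTBD.partialGrad B (PTBD.gsMixHead Ph Ps ℓ) ℓ).PosSemidef) ∧
      ((∀ ℓ, Ph ℓ = Ps ℓ.1) → PTBD.IsPolarKKT B Ps) ∧
      ((∀ ℓ : Fin m, (ℓ : ℕ) + 1 < m → (PTBD.partialGrad B Ps ℓ).rank = ∑ s, κ ℓ s) →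
        (∀ ℓ, Ph ℓ = Ps ℓ.1) ∧ PTBD.IsKKT B Ps ∧ PTBD.IsPolarKKT B Ps)) ∧
    -- (d)
    (∀ Ps : PTBD.Tuple n κ, PTBD.IsIsolatedAccumulationPoint P Ps →
      (∀ ℓ, (PTBD.partialGrad B Ps ℓ).rank = ∑ s, κ ℓ s) →
      Tendsto P atTop (𝓝 Ps)) ∧
    -- (e)
    (∀ ℓ : Fin m,
      Summable (fun j => PTBD.sigmaMin (PTBD.hatGrad B P j ℓ) *
        PTBD.frobNorm (PTBD.sinTheta (PTBD.colSpace (P (j + 1) ℓ))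
          (PTBD.colSpace (P j ℓ))) ^ 2) ∧
      Summable (fun j => PTBD.sigmaMin (PTBD.hatGrad B P j ℓ) *
        (PTBD.frobNorm (PTBD.hatGrad B P j ℓ -
            P j ℓ * ((P j ℓ)ᴴ * PTBD.hatGrad B P j ℓ)) ^ 2 /
          PTBD.frobNorm (PTBD.hatGrad B P j ℓ) ^ 2))) := by
  refine ⟨⟨hP.monotone, ?_⟩, ?_, fun Ps hiso hr => hP.tendsto_of_isIsolated hiso hr,
    fun ℓ => ⟨?_, ?_⟩⟩
  · obtain ⟨M, hM⟩ := hP.exists_objective_le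
    exact ⟨_, tendsto_atTop_ciSup hP.monotone ⟨M, by rintro _ ⟨j, rfl⟩; exact hM j⟩⟩
  · intro Ps φ Ph hφ hPs hPh
    -- along a suitable ultrafilter all `m` matrices of the next iterate converge
    obtain ⟨𝒱, h𝒱, hPh𝒱⟩ := mapClusterPt_iff_ultrafilter.1 hPh
    have h𝒰 : ((𝒱.map φ : Ultrafilter ℕ) : Filter ℕ) ≤ atTop :=
      hφ.tendsto_atTop.mono_left h𝒱
    have hPs𝒰 : Tendsto P (𝒱.map φ : Ultrafilter ℕ) (𝓝 Ps) := hPs.mono_left h𝒱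
    obtain ⟨Q, -, hQ⟩ := PTBD.isCompact_pi_stiefel.ultrafilter_le_nhds
      ((𝒱.map φ).map fun j => P (j + 1)) (le_principal_iff.2 (Filter.Eventually.of_forall
        (f := ((𝒱.map φ : Ultrafilter ℕ) : Filter ℕ)) fun j => hP.mem_pi (j + 1)))
    have hQ𝒰 : Tendsto (fun j => P (j + 1)) (𝒱.map φ : Ultrafilter ℕ) (𝓝 Q) := hQ
    have hhead : ∀ ℓ, Ph ℓ = Q ℓ.1 := fun ℓ =>
      tendsto_nhds_unique ((tendsto_pi_nhds.1 hPh𝒱) ℓ)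
        ((tendsto_pi_nhds.1 hQ𝒰 ℓ.1).comp (tendsto_map (f := φ) (x := (𝒱 : Filter ℕ))))
    have hmix : ∀ ℓ, PTBD.gsMixHead Ph Ps ℓ = PTBD.gsMix Q Ps ℓ := fun ℓ => funext fun i => by
      unfold PTBD.gsMixHead PTBD.gsMix
      split_ifs
      exacts [hhead _, rfl]
    have hb : ∀ ℓ, Ps ℓ ∈ PTBD.Stiefel (Fin (n ℓ)) (PTBD.Cols κ ℓ) ∧
        PTBD.partialGrad B (PTBD.gsMixHead Ph Ps ℓ) ℓ =
          Ps ℓ * ((Ps ℓ)ᴴ * PTBD.partialGrad B (PTBD.gsMixHead Ph Ps ℓ) ℓ) ∧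
        ((Ps ℓ)ᴴ * PTBD.partialGrad B (PTBD.gsMixHead Ph Ps ℓ) ℓ).PosSemidef := fun ℓ => by
      obtain ⟨hS, Λ, hΛ, -, h⟩ := hP.exists_polar_of_tendsto h𝒰 hPs𝒰 hQ𝒰 ℓ
      have hpol : PTBD.IsPolarFactor (PTBD.partialGrad B (PTBD.gsMix Q Ps ℓ) ℓ) (Ps ℓ) :=
        ⟨hS, Λ, hΛ, h⟩
      rw [hmix]
      exact ⟨hS, hpol.posSemidef.2, hpol.posSemidef.1⟩
    have hKKT : (∀ ℓ, Ph ℓ = Ps ℓ.1) → PTBD.IsPolarKKT B Ps := fun h ℓ => by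
      have hmixℓ : PTBD.gsMixHead Ph Ps ℓ = Ps := by
        rw [hmix]
        refine PTBD.gsMix_eq_right fun i hi => ?_
        have him : (i : ℕ) + 1 < m := by omega
        exact (hhead ⟨i, him⟩).symm.trans (h ⟨i, him⟩)
      simpa only [hmixℓ] using hb ℓ
    refine ⟨fun ℓ => (hb ℓ).2, hKKT, fun hr => ?_⟩
    have hh : ∀ ℓ, Ph ℓ = Ps ℓ.1 := fun ℓ => (hhead ℓ).trans <|
      hP.limits_eq_of_rank h𝒰 hPs𝒰 hQ𝒰 (r := m - 1) (fun i hi => hr i (by omega)) ℓ.1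
        (by have := ℓ.2; omega)
    exact ⟨hh, (hKKT hh).isKKT, hKKT hh⟩
  · refine Summable.of_nonneg_of_le (fun j => mul_nonneg (LinearMap.singularValues_nonneg _ _)
      (sq_nonneg _)) (fun j => ?_) (hP.summable_stepGap ℓ)
    exact (mul_le_mul_of_nonneg_left (PTBD.frobNorm_sinTheta_colSpace_le (hP.mem_stiefel j ℓ))
      (LinearMap.singularValues_nonneg _ _)).trans (hP.sigmaMin_mul_le_stepGap hn j ℓ)
  · refine Summable.of_nonneg_of_le (fun j => mul_nonneg (LinearMap.singularValues_nonneg _ _)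
      (by positivity)) (fun j => ?_) (hP.summable_stepGap ℓ)
    exact (mul_le_mul_of_nonneg_left ((hP.2 j ℓ).residual_le (hP.mem_stiefel j ℓ))
      (LinearMap.singularValues_nonneg _ _)).trans (hP.sigmaMin_mul_le_stepGap hn j ℓ)
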